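/- **Conventions.** For a finitely generated module $V$ over a ring $S$, let $d_S(V)$ be the least number of elements generating $V$; for a group $G$ write $d_G$ for $d_{\mathbb{Z}G}$. For a group $A$ (in particular, for the additive group of a module) let $\pi(A)$ be the set of primes dividing the order of some finite subgroup of $A$. Let $M$ be a finitely generated $\mathbb{Z}G$-module and $\pi$ a finite set of primes. For $X\subseteq M$ let $X\mathbb{Z}G$ be the submodule of $M$ generated by $X$. A *nested $\pi$-family* in $M$ is a family $(X_p)_{p\in\pi}$ of subsets of $M$ such that each $X_p$ generates $M$ modulo $pM$ as a $\mathbb{Z}G$-module and has exactly $d_G(M/pM)$ elements, and such that for all $p,q\in\pi$: $X_p\supseteq X_q$ if and only if $d_G(M/pM)\ge d_G(M/qM)$. Its *minimal element* (for $\pi\neq\emptyset$) is the member contained in all the others. Let $\pi_0$ be a finite set of primes. We say that $M$ is *good for $G$ with $\pi(G,M)=\pi_0$* if (g1) there is an integer $\delta$ such that $d_G(M/pM)=\delta$ for all primes $p\notin\pi_0$ and $\delta\le d_G(M/pM)$ for all $p\in\pi_0$; and (g2) for every finite set of primes $\pi$ properly containing $\pi_0$ there is a nested $\pi$-family in $M$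 whose minimal element $X$ satisfies $d_G\bigl(M/(pM+X\mathbb{Z}G)\bigr)\le 1$ for all primes $p\notin\pi$, and such that $M/X\mathbb{Z}G$ is a torsion group of finite exponent. $M$ is *good for $G$* if this holds for some finite set of primes $\pi_0$. **Theorem 7.1.** Let $G$ be a finite group and $M$ a finitely generated $\mathbb{Z}G$-module. 1. For every finite set of primes $\pi$ properly containing $\pi(G)\cup\pi(M)$ there is a nested $\pi$-family in $M$ whose minimal element $X$ satisfies $$d_G\bigl(M/(X\mathbb{Z}G+pM)\bigr)\le 1\quad\text{for every prime } p\notin\pi.$$ 2. Hence $M$ is good for $G$ with $\pi(G,M)=\pi(G)\cup\pi(M)$ (which is a finite set); in particular every finitely generated $\mathbb{Z}G$-module is good for $G$. -/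

import Mathlib

/-- `d_S(V)`: the least number of elements generating the finitely generated `S`-module `V`. -/
noncomputable def genRank (S V : Type*) [Ring S] [AddCommGroup V] [Module S V] : ℕ :=
  (⊤ : Submodule S V).spanFinrank

/-- The submodule `pM = {p • m | m ∈ M}` of the `ℤG`-module `M`. -/
noncomputable def modMul (G M : Type*) [Group G] [AddCommGroup M] [Module (MonoidAlgebra ℤ G) M]
    (p : Nat.Primes) : Submodule (MonoidAlgebra ℤ G) M :=
  LinearMap.range ((p : ℕ) • (LinearMap.id : M →ₗ[MonoidAlgebra ℤ G] M))

/-- `X ℤG`: the `ℤG`-submodule of `M` generated by the subset `X`. -/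
noncomputable def genBy (G : Type*) {M : Type*} [Group G] [AddCommGroup M] [Module (MonoidAlgebra ℤ G) M]
    (X : Set M) : Submodule (MonoidAlgebra ℤ G) M :=
  Submodule.span (MonoidAlgebra ℤ G) X

/-- `d_G(M/pM)`. -/
noncomputable def genRankMod (G M : Type*) [Group G] [AddCommGroup M]
    [Module (MonoidAlgebra ℤ G) M] (p : Nat.Primes) : ℕ :=
  genRank (MonoidAlgebra ℤ G) (M ⧸ modMul G M p)

/-- `π(G)`: the primes dividing the orders of the finite subgroups of `G`. -/
def groupPrimes (G : Type*) [Group G] : Set Nat.Primes :=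
  {p | ∃ H : Subgroup G, Finite H ∧ (p : ℕ) ∣ Nat.card H}

/-- `π(M)`: the primes dividing the orders of the finite subgroups of the additive group `M`. -/
def addGroupPrimes (M : Type*) [AddCommGroup M] : Set Nat.Primes :=
  {p | ∃ H : AddSubgroup M, Finite H ∧ (p : ℕ) ∣ Nat.card H}

/-- A nested `π`-family in the finitely generated `ℤG`-module `M`: every `X p` is a
`ℤG`-generating set of `M` modulo `pM` with the minimum number `d_G(M/pM)` of elements, and
`X p ⊇ X q` if and only if `d_G(M/pM) ≥ d_G(M/qM)`. -/
structure IsNestedFamily (G : Type*) {M : Type*} [Group G] [AddCommGroup M]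
    [Module (MonoidAlgebra ℤ G) M] (π : Finset Nat.Primes) (X : π → Set M) : Prop where
  generates : ∀ p : π, genBy G (X p) ⊔ modMul G M p = ⊤
  card_eq : ∀ p : π, (X p).encard = genRankMod G M p
  nested : ∀ p q : π, X q ⊆ X p ↔ genRankMod G M q ≤ genRankMod G M p

/-- `Y` is the minimal element of the family `X`: a member contained in every member. -/
def IsMinimalElement {M : Type*} {π : Finset Nat.Primes} (X : π → Set M) (Y : Set M) : Prop :=
  (∃ q : π, Y = X q) ∧ ∀ p : π, Y ⊆ X p

/-- The finitely generated `ℤG`-module `M` is good for `G` with `π(G,M) = π₀`. -/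
structure IsGoodWith (G M : Type*) [Group G] [AddCommGroup M] [Module (MonoidAlgebra ℤ G) M]
    [Module.Finite (MonoidAlgebra ℤ G) M] (π₀ : Set Nat.Primes) : Prop where
  finite : π₀.Finite
  g1 : ∃ δ : ℕ, (∀ p ∉ π₀, genRankMod G M p = δ) ∧ ∀ p ∈ π₀, δ ≤ genRankMod G M p
  g2 : ∀ π : Finset Nat.Primes, π₀ ⊂ (π : Set Nat.Primes) →
    ∃ (X : π → Set M) (Y : Set M), IsNestedFamily G π X ∧ IsMinimalElement X Y ∧
      (∀ p ∉ π, genRank (MonoidAlgebra ℤ G) (M ⧸ (modMul G M p ⊔ genBy G Y)) ≤ 1) ∧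
      ∃ n : ℕ, 0 < n ∧ ∀ x : M ⧸ genBy G Y, n • x = 0

/-- The finitely generated `ℤG`-module `M` is good for `G`. -/
def IsGood (G M : Type*) [Group G] [AddCommGroup M] [Module (MonoidAlgebra ℤ G) M]
    [Module.Finite (MonoidAlgebra ℤ G) M] : Prop :=
  ∃ π₀ : Set Nat.Primes, IsGoodWith G M π₀

/-!
The minimum of `d_G(M/qM)` is attained at every prime `p` outside `π(G) ∪ π(M)`. Lift minimal
generators of `M/qM` to `M` and let `L` be the submodule they generate; by Nakayama, `nM ⊆ L` for
some `n` prime to `q`. Peeling off the prime factors of `n` shows `L/pL ≅ M/pM`: for submodules with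
`rL' ⊆ K ⊆ L'` and `r` prime, the inclusion `K → L'` and multiplication by `r` from `L'` to `K`
compose to `r` in both orders. Modulo `p ≠ r` they are isomorphisms, and modulo `p = r` they are
exact at both terms, which makes the two semisimple modules isomorphic (Maschke, as `p ∤ |G|`).
Hence `d_G(M/pM) ≤ d_G(L) ≤ d_G(M/qM)`.

For the family, choose `v₀, v₁, …` by the Chinese remainder theorem so that the first `d_G(M/pM)`
of them generate `M/pM` for each `p ∈ π`. Fix `q ∈ π` outside `π(G) ∪ π(M)` and correct the first
`d_G(M/qM)` of the `vᵢ` one at a time, keeping their residues at `π`. At the primes outside `π`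
the number of generators needed exceeds the number of `vᵢ` still to be corrected by at most one.
Together with the corrected ones these `vᵢ` generate modulo `q`, hence modulo all but finitely
many primes, where their number bounds the rank after any choice of the next one; at the finitely
many remaining primes outside `π` the next one is changed so that the quotient by it needs one
generator fewer.
-/

open Set (Iio)

theorem image_Iio_add_one {α : Type*} (x : ℕ → α) (k : ℕ) :
    x '' Iio (k + 1) = insert (x 0) ((fun i ↦ x (i + 1)) '' Iio k) := by
  ext a
  constructor
  · rintro ⟨_ | i, hi, rfl⟩
    · exact Or.inl rfl
    · exact Or.inr ⟨i, Nat.lt_of_succ_lt_succ hi, rfl⟩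
  · rintro (rfl | ⟨i, hi, rfl⟩)
    · exact ⟨0, k.succ_pos, rfl⟩
    · exact ⟨i + 1, Nat.succ_lt_succ hi, rfl⟩

theorem encard_image_Iio_le {α : Type*} (x : ℕ → α) (k : ℕ) : (x '' Iio k).encard ≤ k :=
  (Set.encard_image_le x (Iio k)).trans_eq <| by
    rw [← Finset.coe_range, Set.encard_coe_eq_coe_finsetCard, Finset.card_range]

section Generators

open Submodule

variable {R M : Type*} [Ring R] [AddCommGroup M] [Module R M]

theorem spanFinrank_le_of_encard_le {s : Set M} {k : ℕ} (hs : s.encard ≤ k) :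
    (span R s).spanFinrank ≤ k :=
  Nat.cast_le.1 ((spanFinrank_span_le_encard s).trans hs)

theorem genRank_quotient_le_of_encard_le {N : Submodule R M} {s : Set M} {k : ℕ}
    (hs : s.encard ≤ k) (h : span R s ⊔ N = ⊤) : genRank R (M ⧸ N) ≤ k := by
  have hspan : span R (N.mkQ '' s) = ⊤ := by
    rw [← map_span, map_mkQ_eq_top, sup_comm, h]
  rw [genRank, ← hspan]
  exact spanFinrank_le_of_encard_le ((Set.encard_image_le _ _).trans hs)

theorem genRank_quotient_le_iff [Module.Finite R M] {N : Submodule R M} {k : ℕ} :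
    genRank R (M ⧸ N) ≤ k ↔ ∃ x : ℕ → M, span R (x '' Iio k) ⊔ N = ⊤ := by
  refine ⟨fun h ↦ ?_, fun ⟨x, hx⟩ ↦
    genRank_quotient_le_of_encard_le (encard_image_Iio_le x k) hx⟩
  obtain ⟨s, hcard, hspan⟩ :=
    (Module.Finite.fg_top (R := R) (M := M ⧸ N)).exists_span_finset_card_eq_spanFinrank
  let lift : M ⧸ N → M := Function.surjInv N.mkQ_surjective
  refine ⟨fun i ↦ lift (s.toList.getD i 0), ?_⟩
  rw [sup_comm, ← map_mkQ_eq_top, map_span, eq_top_iff, ← hspan]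
  refine span_mono fun a ha ↦ ?_
  obtain ⟨i, hi, rfl⟩ := List.mem_iff_getElem.1 (Finset.mem_toList.2 ha)
  have hik : i < k := (hi.trans_eq (s.length_toList.trans hcard)).trans_le h
  exact ⟨_, ⟨i, hik, rfl⟩, by simp [lift, Function.surjInv_eq, List.getElem?_eq_getElem hi]⟩

theorem genRank_quotient_anti [Module.Finite R M] {N N' : Submodule R M} (h : N ≤ N') :
    genRank R (M ⧸ N') ≤ genRank R (M ⧸ N) := by
  obtain ⟨x, hx⟩ := genRank_quotient_le_iff.1 (le_refl (genRank R (M ⧸ N)))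
  exact genRank_quotient_le_iff.2 ⟨x, top_unique (hx.ge.trans (sup_le_sup_left h _))⟩

theorem exists_genRank_quotient_span_singleton_sup_le [Module.Finite R M] {N : Submodule R M}
    {k : ℕ} (h : genRank R (M ⧸ N) ≤ k + 1) :
    ∃ z : M, genRank R (M ⧸ (span R {z} ⊔ N)) ≤ k := by
  obtain ⟨x, hx⟩ := genRank_quotient_le_iff.1 h
  refine ⟨x 0, genRank_quotient_le_iff.2 ⟨fun i ↦ x (i + 1), ?_⟩⟩
  rwa [← sup_assoc, sup_comm (span R _) (span R {x 0}), ← span_insert, ← image_Iio_add_one]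

theorem genRank_le_of_surjective [Module.Finite R M] {P : Type*} [AddCommGroup P] [Module R P]
    {f : M →ₗ[R] P} (hf : Function.Surjective f) : genRank R P ≤ genRank R M := by
  rw [genRank, genRank, ← LinearMap.range_eq_top.2 hf, LinearMap.range_eq_map]
  exact spanFinrank_map_le_of_fg f Module.Finite.fg_top

theorem span_image_sup_congr {ι : Type*} {N : Submodule R M} {s : Set ι} {x y : ι → M}
    (h : ∀ i ∈ s, x i ≡ y i [SMOD N]) : span R (x '' s) ⊔ N = span R (y '' s) ⊔ N := by
  have himage : N.mkQ '' (x '' s) = N.mkQ '' (y '' s) := by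
    rw [Set.image_image, Set.image_image]
    exact Set.image_congr h
  rw [sup_comm, ← comap_map_mkQ, map_span, himage, ← map_span, comap_map_mkQ, sup_comm]

theorem span_singleton_sup_congr {N : Submodule R M} {x y : M} (h : x ≡ y [SMOD N]) :
    span R {x} ⊔ N = span R {y} ⊔ N := by
  simpa using span_image_sup_congr (s := Set.univ) (x := fun _ : Unit ↦ x) fun _ _ ↦ h

end Generators

section Multiples

open Submodule

/-- `nM`, the submodule of `n`-fold multiples of elements of a module `M` over any ring `R`.
`modMul G M p` is by definition the case `R = ℤG`, `n = p`. -/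
def multiples (R M : Type*) [Ring R] [AddCommGroup M] [Module R M] (n : ℕ) : Submodule R M :=
  LinearMap.range (n • (LinearMap.id : M →ₗ[R] M))

/-- The reduction `M/nM` of the module `M` modulo `n`. -/
abbrev Reduction (R M : Type*) [Ring R] [AddCommGroup M] [Module R M] (n : ℕ) : Type _ :=
  M ⧸ multiples R M n

variable {R M : Type*} [Ring R] [AddCommGroup M] [Module R M] {m n : ℕ}

theorem nsmul_mem_multiples (n : ℕ) (x : M) : n • x ∈ multiples R M n :=
  ⟨x, rfl⟩

theorem multiples_anti (h : m ∣ n) : multiples R M n ≤ multiples R M m := by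
  obtain ⟨k, rfl⟩ := h
  rintro _ ⟨x, rfl⟩
  exact ⟨k • x, (mul_nsmul' x m k).symm⟩

theorem nsmul_reduction_eq_zero (x : Reduction R M n) : n • x = 0 := by
  obtain ⟨y, rfl⟩ := mkQ_surjective _ x
  rw [← map_nsmul]
  exact (Quotient.mk_eq_zero _).2 (nsmul_mem_multiples n y)

theorem exists_sModEq_multiples_of_coprime (h : m.Coprime n) (x y : M) :
    ∃ w : M, w ≡ x [SMOD multiples R M m] ∧ w ≡ y [SMOD multiples R M n] := by
  obtain ⟨a, b, hab⟩ := Nat.isCoprime_iff_coprime.2 h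
  refine ⟨(b * n) • x + (a * m) • y, SModEq.sub_mem.2 ⟨a • (y - x), ?_⟩,
    SModEq.sub_mem.2 ⟨b • (x - y), ?_⟩⟩
  · simp only [LinearMap.smul_apply, LinearMap.id_apply]
    rw [eq_sub_of_add_eq' hab]
    module
  · simp only [LinearMap.smul_apply, LinearMap.id_apply]
    rw [eq_sub_of_add_eq hab]
    module

theorem exists_forall_sModEq_multiples {ι : Type*} {n : ι → ℕ} (T : Finset ι)
    (hn : (T : Set ι).Pairwise (Function.onFun Nat.Coprime n)) (z : ι → M) :
    ∃ w : M, ∀ i ∈ T, w ≡ z i [SMOD multiples R M (n i)] := by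
  classical
  induction T using Finset.induction_on with
  | empty => exact ⟨0, by simp⟩
  | insert i T hi ih =>
    rw [Finset.coe_insert, Set.pairwise_insert_of_notMem (by simpa using hi)] at hn
    obtain ⟨w, hw⟩ := ih hn.1
    have hcop : (n i).Coprime (∏ j ∈ T, n j) :=
      Nat.Coprime.prod_right fun j hj ↦ (hn.2 j hj).1
    obtain ⟨w', hi', hT⟩ := exists_sModEq_multiples_of_coprime (R := R) hcop (z i) w
    refine ⟨w', Finset.forall_mem_insert _ _ _ |>.2 ⟨hi', fun j hj ↦ ?_⟩⟩
    exact (hT.mono (multiples_anti (Finset.dvd_prod_of_mem n hj))).trans (hw j hj)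

theorem sup_multiples_eq_top_of_coprime {L : Submodule R M} (hmn : m.Coprime n)
    (h : ∀ x : M, m • x ∈ L) : L ⊔ multiples R M n = ⊤ := by
  refine eq_top_iff.2 fun x _ ↦ ?_
  obtain ⟨w, hw, hwx⟩ := exists_sModEq_multiples_of_coprime (R := R) hmn 0 x
  obtain ⟨y, rfl⟩ := SModEq.zero.1 hw
  rw [← sub_sub_cancel (m • y) x]
  exact sub_mem (mem_sup_left (h y)) (mem_sup_right (SModEq.sub_mem.1 hwx))

/-- Nakayama's lemma over `ℤ`. -/
theorem exists_coprime_forall_nsmul_mem [Module.Finite ℤ M] {L : Submodule R M}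
    (h : L ⊔ multiples R M n = ⊤) : ∃ m : ℕ, m.Coprime n ∧ ∀ x : M, m • x ∈ L := by
  have hle : (⊤ : Submodule ℤ M) ≤ L.restrictScalars ℤ ⊔ Ideal.span {(n : ℤ)} • ⊤ := by
    intro x _
    obtain ⟨l, hl, _, ⟨y, rfl⟩, rfl⟩ := mem_sup.1 (h.ge (mem_top (x := x)))
    refine add_mem (mem_sup_left hl) (mem_sup_right ?_)
    simpa using smul_mem_smul (Ideal.mem_span_singleton_self (n : ℤ)) (mem_top (x := y))
  obtain ⟨r, hr, hrL⟩ := exists_sub_one_mem_and_smul_le_of_fg_of_le_sup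
    Module.Finite.fg_top le_top hle
  have hcop : IsCoprime r n := by
    obtain ⟨c, hc⟩ := Ideal.mem_span_singleton.1 hr
    exact ⟨1, -c, by linarith⟩
  refine ⟨r.natAbs, Int.isCoprime_iff_gcd_eq_one.1 hcop, fun x ↦ ?_⟩
  have hrx : r • x ∈ L := hrL (smul_mem_pointwise_smul x r ⊤ mem_top)
  rw [← natCast_zsmul, Int.natCast_natAbs]
  rcases abs_choice r with hr | hr <;> simpa [hr] using hrx

theorem pairwise_coprime_primes (T : Set Nat.Primes) :
    T.Pairwise (Function.onFun Nat.Coprime fun p ↦ p) := fun p _ p' _ hne ↦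
  (Nat.coprime_primes p.2 p'.2).2 (Subtype.coe_injective.ne hne)

theorem finite_setOf_prime_dvd {n : ℕ} (hn : n ≠ 0) : {p : Nat.Primes | (p : ℕ) ∣ n}.Finite :=
  (n.primeFactors.finite_toSet.preimage Subtype.val_injective.injOn).subset fun p hp ↦
    Nat.mem_primeFactors.2 ⟨p.2, hp, hn⟩

theorem finite_setOf_sup_multiples_ne_top [Module.Finite ℤ M] {L : Submodule R M} (hn : n ≠ 1)
    (h : L ⊔ multiples R M n = ⊤) : {p : Nat.Primes | L ⊔ multiples R M p ≠ ⊤}.Finite := by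
  obtain ⟨m, hm, hmL⟩ := exists_coprime_forall_nsmul_mem h
  have hm0 : m ≠ 0 := fun h0 ↦ hn (n.coprime_zero_left.1 (h0 ▸ hm))
  refine (finite_setOf_prime_dvd hm0).subset fun p hp ↦ ?_
  by_contra hdvd
  exact hp (sup_multiples_eq_top_of_coprime ((p.2.coprime_iff_not_dvd).2 hdvd).symm hmL)

end Multiples

section Reduction

open Submodule

variable {R : Type*} [Ring R] {M N : Type*} [AddCommGroup M] [Module R M] [AddCommGroup N]
  [Module R N]

theorem nonempty_linearEquiv_ker_prod_range [IsSemisimpleModule R M] (f : M →ₗ[R] N) :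
    Nonempty (M ≃ₗ[R] LinearMap.ker f × LinearMap.range f) := by
  obtain ⟨C, hC⟩ := exists_isCompl (LinearMap.ker f)
  exact ⟨(prodEquivOfIsCompl _ C hC).symm ≪≫ₗ
    (LinearEquiv.refl R _).prodCongr ((quotientEquivOfIsCompl _ C hC).symm ≪≫ₗ f.quotKerEquivRange)⟩

/-- Both modules are isomorphic to `ker f × ker g`. -/
theorem nonempty_linearEquiv_of_exact_of_exact [IsSemisimpleModule R M] [IsSemisimpleModule R N]
    {f : M →ₗ[R] N} {g : N →ₗ[R] M} (hfg : Function.Exact f g) (hgf : Function.Exact g f) :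
    Nonempty (M ≃ₗ[R] N) := by
  obtain ⟨e⟩ := nonempty_linearEquiv_ker_prod_range f
  obtain ⟨e'⟩ := nonempty_linearEquiv_ker_prod_range g
  exact ⟨e ≪≫ₗ LinearEquiv.prodComm R _ _ ≪≫ₗ
    (LinearEquiv.ofEq _ _ (LinearMap.exact_iff.1 hfg).symm).prodCongr
      (LinearEquiv.ofEq _ _ (LinearMap.exact_iff.1 hgf)) ≪≫ₗ e'.symm⟩

theorem multiples_le_comap (n : ℕ) (f : M →ₗ[R] N) :
    multiples R M n ≤ (multiples R N n).comap f := by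
  rintro _ ⟨x, rfl⟩
  exact ⟨f x, (map_nsmul f n x).symm⟩

/-- The map `M/nM → N/nN` induced by a linear map `M → N`. -/
def Reduction.map (n : ℕ) (f : M →ₗ[R] N) : Reduction R M n →ₗ[R] Reduction R N n :=
  mapQ _ _ f (multiples_le_comap n f)

theorem Reduction.map_mkQ (n : ℕ) (f : M →ₗ[R] N) (x : M) :
    Reduction.map n f ((multiples R M n).mkQ x) = (multiples R N n).mkQ (f x) :=
  rfl

theorem Reduction.exact_map_map {n : ℕ} {i : M →ₗ[R] N} {t : N →ₗ[R] M}
    (hti : ∀ x, t (i x) = n • x) (ht : Function.Injective t) :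
    Function.Exact (Reduction.map n i) (Reduction.map n t) := by
  intro y
  obtain ⟨y, rfl⟩ := mkQ_surjective _ y
  constructor
  · intro hy
    obtain ⟨x, hx⟩ := (Quotient.mk_eq_zero _).1 hy
    have hxy : i x = y := ht ((hti x).trans hx)
    exact ⟨mkQ _ x, congrArg _ hxy⟩
  · rintro ⟨x, hx⟩
    obtain ⟨x, rfl⟩ := mkQ_surjective _ x
    rw [← hx, Reduction.map_mkQ, Reduction.map_mkQ, hti]
    exact (Quotient.mk_eq_zero _).2 (nsmul_mem_multiples n x)

theorem Reduction.map_injective_of_coprime {m n : ℕ} (hmn : m.Coprime n) {i : M →ₗ[R] N}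
    {t : N →ₗ[R] M} (hti : ∀ x, t (i x) = m • x) : Function.Injective (Reduction.map n i) := by
  refine (injective_iff_map_eq_zero _).2 fun x hx ↦ ?_
  obtain ⟨a, b, hab⟩ := Nat.isCoprime_iff_coprime.2 hmn
  have hm : m • x = 0 := by
    obtain ⟨x, rfl⟩ := mkQ_surjective _ x
    rw [← map_nsmul, ← hti, ← Reduction.map_mkQ, ← Reduction.map_mkQ, hx, map_zero]
  have hn : n • x = 0 := nsmul_reduction_eq_zero x
  rw [← one_zsmul x, ← hab, add_zsmul, mul_zsmul, mul_zsmul, natCast_zsmul, natCast_zsmul, hm, hn,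
    zsmul_zero, zsmul_zero, add_zero]

theorem Reduction.map_surjective_of_coprime {m n : ℕ} (hmn : m.Coprime n) {i : M →ₗ[R] N}
    (hi : ∀ y, m • y ∈ LinearMap.range i) : Function.Surjective (Reduction.map n i) := by
  refine LinearMap.range_eq_top.1 ?_
  rw [Reduction.map, range_mapQ, map_mkQ_eq_top, sup_comm]
  exact sup_multiples_eq_top_of_coprime hmn hi

theorem nonempty_reduction_linearEquiv_of_prime {p r : ℕ} (hp : p.Prime) (hr : r.Prime)
    (hM : IsSMulRegular M p) [∀ K : Submodule R M, IsSemisimpleModule R (Reduction R K p)]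
    {K L : Submodule R M} (hKL : K ≤ L) (hL : ∀ x ∈ L, r • x ∈ K) :
    Nonempty (Reduction R K p ≃ₗ[R] Reduction R L p) := by
  let i : K →ₗ[R] L := inclusion hKL
  let t : L →ₗ[R] K := (r • L.subtype).codRestrict K fun x ↦ hL x x.2
  have hti (x : K) : t (i x) = r • x := rfl
  have hit (x : L) : i (t x) = r • x := rfl
  rcases eq_or_ne r p with rfl | hrp
  · have ht : Function.Injective t := fun x y h ↦ Subtype.ext (hM (congrArg Subtype.val h))
    exact nonempty_linearEquiv_of_exact_of_exact (Reduction.exact_map_map hti ht)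
      (Reduction.exact_map_map hit (inclusion_injective hKL))
  · have hcop : r.Coprime p := (Nat.coprime_primes hr hp).2 hrp
    exact ⟨LinearEquiv.ofBijective (Reduction.map p i)
      ⟨Reduction.map_injective_of_coprime hcop hti,
        Reduction.map_surjective_of_coprime hcop fun y ↦ ⟨t y, hit y⟩⟩⟩

theorem nonempty_reduction_linearEquiv {p n : ℕ} (hp : p.Prime) (hM : IsSMulRegular M p)
    [∀ K : Submodule R M, IsSemisimpleModule R (Reduction R K p)] (hn : n ≠ 0)
    {K L : Submodule R M} (hKL : K ≤ L) (hL : ∀ x ∈ L, n • x ∈ K) :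
    Nonempty (Reduction R K p ≃ₗ[R] Reduction R L p) := by
  induction n using induction_on_primes generalizing L with
  | zero => exact absurd rfl hn
  | one =>
    obtain rfl : K = L := hKL.antisymm fun x hx ↦ by simpa using hL x hx
    exact ⟨LinearEquiv.refl R _⟩
  | prime_mul r a hr ih =>
    let L' : Submodule R M := L ⊓ K.comap (a • LinearMap.id)
    have hKL' : K ≤ L' := le_inf hKL fun x hx ↦ nsmul_mem hx a
    have hL' : ∀ x ∈ L, r • x ∈ L' := fun x hx ↦
      ⟨nsmul_mem hx r, by simpa [mul_nsmul'] using hL x hx⟩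
    obtain ⟨e⟩ := ih (right_ne_zero_of_mul hn) hKL' fun x hx ↦ hx.2
    obtain ⟨e'⟩ := nonempty_reduction_linearEquiv_of_prime hp hr hM inf_le_left hL'
    exact ⟨e ≪≫ₗ e'⟩

theorem genRank_reduction_le [Module.Finite ℤ M] {p : ℕ} (hp : p.Prime) (hM : IsSMulRegular M p)
    [∀ K : Submodule R M, IsSemisimpleModule R (Reduction R K p)] {q : ℕ} (hq : q ≠ 1) :
    genRank R (Reduction R M p) ≤ genRank R (Reduction R M q) := by
  have : Module.Finite R M := Module.Finite.of_restrictScalars_finite ℤ R M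
  obtain ⟨x, hx⟩ := genRank_quotient_le_iff.1 (le_refl (genRank R (Reduction R M q)))
  let L : Submodule R M := span R (x '' Iio (genRank R (Reduction R M q)))
  have : Module.Finite R L := .of_fg (fg_span ((Set.finite_Iio _).image x))
  obtain ⟨n, hn, hnL⟩ := exists_coprime_forall_nsmul_mem hx
  have hn0 : n ≠ 0 := fun h ↦ hq (q.coprime_zero_left.1 (h ▸ hn))
  obtain ⟨e⟩ := nonempty_reduction_linearEquiv hp hM hn0 (le_top (a := L)) fun y _ ↦ hnL y
  have htop : Function.Surjective (Reduction.map p (⊤ : Submodule R M).subtype) :=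
    Reduction.map_surjective_of_coprime (Nat.coprime_one_left p) fun y ↦ ⟨⟨1 • y, mem_top⟩, rfl⟩
  have hsurj : Function.Surjective
      (Reduction.map p (⊤ : Submodule R M).subtype ∘ₗ e.toLinearMap ∘ₗ (multiples R L p).mkQ) :=
    htop.comp (e.surjective.comp (mkQ_surjective _))
  calc genRank R (Reduction R M p)
      ≤ genRank R L := genRank_le_of_surjective hsurj
    _ = L.spanFinrank := spanFinrank_top L
    _ ≤ genRank R (Reduction R M q) :=
      spanFinrank_le_of_encard_le (encard_image_Iio_le x _)

end Reduction

section Maschke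

variable {k G V : Type*} [CommRing k] [Group G] [Finite G] [AddCommGroup V] [Module k V]
  [Module (MonoidAlgebra k G) V] [IsScalarTower k (MonoidAlgebra k G) V]

/-- Unlike in Mathlib's version of Maschke's theorem, `|G|` need only be invertible on `V`, which
allows `k = ℤ`. -/
theorem isSemisimpleModule_monoidAlgebra [IsSemisimpleModule k V] {a : k}
    (ha : ∀ v : V, a • Nat.card G • v = v) : IsSemisimpleModule (MonoidAlgebra k G) V where
  exists_isCompl W := by
    cases nonempty_fintype G
    obtain ⟨π, hπ⟩ := IsSemisimpleModule.extension_property (W.subtype.restrictScalars k)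
      W.subtype_injective LinearMap.id
    refine ⟨_, LinearMap.isCompl_of_proj (f := a • π.sumOfConjugatesEquivariant G) fun w ↦ ?_⟩
    have hconj (g : G) : π.conjugate g w = w :=
      π.conjugate_i W.subtype (LinearMap.congr_fun hπ) g w
    rw [LinearMap.smul_apply, LinearMap.sumOfConjugatesEquivariant_apply]
    simp only [hconj, Finset.sum_const, Finset.card_univ, Fintype.card_eq_nat_card]
    exact Subtype.ext (ha w)

end Maschke

theorem isSemisimpleModule_int_of_prime_nsmul_eq_zero {V : Type*} [AddCommGroup V] {p : ℕ}
    (hp : p.Prime) (hV : ∀ v : V, p • v = 0) : IsSemisimpleModule ℤ V := by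
  have : Fact p.Prime := ⟨hp⟩
  let _ : Module (ZMod p) V := AddCommGroup.zmodModule hV
  let e : V →ₛₗ[Int.castRingHom (ZMod p)] V :=
    { AddMonoidHom.id V with map_smul' := fun a v ↦ (Int.cast_smul_eq_zsmul (ZMod p) a v).symm }
  have : RingHomSurjective (Int.castRingHom (ZMod p)) := ⟨ZMod.intCast_surjective⟩
  exact (e.isSemisimpleModule_iff_of_bijective Function.bijective_id).2 (by infer_instance)

theorem isSemisimpleModule_of_prime_nsmul_eq_zero {G V : Type*} [Group G] [Finite G]
    [AddCommGroup V] [Module (MonoidAlgebra ℤ G) V] {p : ℕ} (hp : p.Prime)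
    (hG : ¬ p ∣ Nat.card G) (hV : ∀ v : V, p • v = 0) :
    IsSemisimpleModule (MonoidAlgebra ℤ G) V := by
  have := isSemisimpleModule_int_of_prime_nsmul_eq_zero hp hV
  obtain ⟨a, b, hab⟩ := Nat.isCoprime_iff_coprime.2 ((hp.coprime_iff_not_dvd).2 hG).symm
  refine isSemisimpleModule_monoidAlgebra (a := a) fun v ↦ ?_
  rw [← natCast_zsmul, smul_smul, eq_sub_of_add_eq hab, sub_smul, mul_smul, natCast_zsmul, hV,
    smul_zero, sub_zero, one_smul]

section Lifting

open Submodule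

variable {R M : Type*} [Ring R] [AddCommGroup M] [Module R M] [Module.Finite ℤ M]
  {π : Finset Nat.Primes} {q : Nat.Primes} {K : Submodule R M}

theorem exists_sModEq_forall_genRank_quotient_le {v : ℕ → M} {k : ℕ}
    (hv : span R (v '' Iio (k + 1)) ⊔ K ⊔ multiples R M q = ⊤)
    (hK : ∀ p ∉ π, genRank R (M ⧸ (K ⊔ multiples R M p)) ≤ k + 2) :
    ∃ w : M, (∀ p ∈ π, w ≡ v 0 [SMOD multiples R M p]) ∧
      ∀ p ∉ π, genRank R (M ⧸ (span R {w} ⊔ (K ⊔ multiples R M p))) ≤ k + 1 := by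
  have : Module.Finite R M := .of_restrictScalars_finite ℤ R M
  have hbad := finite_setOf_sup_multiples_ne_top q.2.ne_one hv
  have hz (p : Nat.Primes) : ∃ z : M, (p ∈ π → z = v 0) ∧
      (p ∉ π → genRank R (M ⧸ (span R {z} ⊔ (K ⊔ multiples R M p))) ≤ k + 1) := by
    by_cases hp : p ∈ π
    · exact ⟨v 0, fun _ ↦ rfl, fun h ↦ absurd hp h⟩
    · obtain ⟨z, hz⟩ := exists_genRank_quotient_span_singleton_sup_le (hK p hp)
      exact ⟨z, fun h ↦ absurd h hp, fun _ ↦ hz⟩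
  choose z hzπ hz using hz
  obtain ⟨w, hw⟩ := exists_forall_sModEq_multiples (R := R) (π ∪ hbad.toFinset)
    (pairwise_coprime_primes _) z
  refine ⟨w, fun p hp ↦ hzπ p hp ▸ hw p (Finset.mem_union_left _ hp), fun p hp ↦ ?_⟩
  by_cases hgood : span R (v '' Iio (k + 1)) ⊔ K ⊔ multiples R M p = ⊤
  · rw [sup_assoc] at hgood
    exact (genRank_quotient_anti le_sup_right).trans (genRank_quotient_le_iff.2 ⟨v, hgood⟩)
  · have hwz := hw p (Finset.mem_union_right _ (hbad.mem_toFinset.2 hgood))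
    rw [span_singleton_sup_congr (hwz.mono le_sup_right)]
    exact hz p hp

theorem exists_sModEq_forall_genRank_quotient_le_one (hq : q ∈ π) {k : ℕ} {v : ℕ → M}
    (hv : span R (v '' Iio k) ⊔ K ⊔ multiples R M q = ⊤)
    (hK : ∀ p ∉ π, genRank R (M ⧸ (K ⊔ multiples R M p)) ≤ k + 1) :
    ∃ x : ℕ → M, (∀ p ∈ π, ∀ i, x i ≡ v i [SMOD multiples R M p]) ∧
      ∀ p ∉ π, genRank R (M ⧸ (span R (x '' Iio k) ⊔ K ⊔ multiples R M p)) ≤ 1 := by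
  induction k generalizing K v with
  | zero =>
    refine ⟨v, fun _ _ _ ↦ .rfl, fun p hp ↦ ?_⟩
    rw [← Nat.bot_eq_zero, Set.Iio_bot, Set.image_empty, span_empty, bot_sup_eq]
    exact hK p hp
  | succ k ih =>
    obtain ⟨w, hwv, hw⟩ := exists_sModEq_forall_genRank_quotient_le hv hK
    have hsplit (x : ℕ → M) : span R (x '' Iio (k + 1)) ⊔ K =
        span R ((fun i ↦ x (i + 1)) '' Iio k) ⊔ (span R {x 0} ⊔ K) := by
      rw [image_Iio_add_one, span_insert, sup_comm (span R {x 0}), sup_assoc]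
    have htail : span R ((fun i ↦ v (i + 1)) '' Iio k) ⊔ (span R {w} ⊔ K) ⊔ multiples R M q =
        ⊤ := by
      rw [sup_assoc, sup_assoc, span_singleton_sup_congr ((hwv q hq).mono le_sup_right),
        ← sup_assoc, ← sup_assoc, sup_assoc (span R _), ← hsplit, hv]
    obtain ⟨x, hxv, hx⟩ := ih htail fun p hp ↦ by
      rw [sup_assoc]
      exact hw p hp
    let x' : ℕ → M := fun | 0 => w | i + 1 => x i
    refine ⟨x', fun p hp ↦ ?_, fun p hp ↦ ?_⟩
    · rintro (_ | i)
      exacts [hwv p hp, hxv p hp i]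
    · rw [hsplit]
      exact hx p hp

end Lifting

theorem not_dvd_card_of_notMem_groupPrimes {G : Type*} [Group G] [Finite G] {p : Nat.Primes}
    (hp : p ∉ groupPrimes G) : ¬ (p : ℕ) ∣ Nat.card G := fun h ↦
  hp ⟨⊤, inferInstance, by rwa [Subgroup.card_top]⟩

theorem isSMulRegular_of_notMem_addGroupPrimes {M : Type*} [AddCommGroup M] {p : Nat.Primes}
    (hp : p ∉ addGroupPrimes M) : IsSMulRegular M (p : ℕ) := by
  refine isSMulRegular_iff_right_eq_zero_of_smul.2 fun m hm ↦ ?_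
  by_contra h
  have : Fact (p : ℕ).Prime := ⟨p.2⟩
  have hcard : Nat.card (AddSubgroup.zmultiples m) = p := by
    rw [Nat.card_zmultiples, addOrderOf_eq_prime hm h]
  exact hp ⟨AddSubgroup.zmultiples m,
    Nat.finite_of_card_ne_zero (by rw [hcard]; exact p.2.ne_zero), hcard ▸ dvd_rfl⟩

theorem finite_groupPrimes (G : Type*) [Group G] [Finite G] : (groupPrimes G).Finite :=
  (finite_setOf_prime_dvd Nat.card_pos.ne').subset fun _ ⟨H, _, hH⟩ ↦
    hH.trans H.card_subgroup_dvd_card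

theorem finite_addGroupPrimes (M : Type*) [AddCommGroup M] [Module.Finite ℤ M] :
    (addGroupPrimes M).Finite := by
  let T := (Submodule.torsion ℤ M).toAddSubgroup
  have : Finite T :=
    Module.finite_of_fg_torsion (Submodule.torsion ℤ M) Submodule.torsion_isTorsion
  refine (finite_setOf_prime_dvd (n := Nat.card T) Nat.card_pos.ne').subset
    fun p ⟨H, _, hH⟩ ↦ hH.trans (AddSubgroup.card_dvd_of_le fun h hh ↦ ?_)
  have hcard : Nat.card H • h = 0 :=
    congrArg Subtype.val (card_nsmul_eq_zero' (x := (⟨h, hh⟩ : H)))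
  exact (Submodule.mem_torsion_iff h).2 ⟨⟨(Nat.card H : ℤ),
    mem_nonZeroDivisors_of_ne_zero (Nat.cast_ne_zero.2 Nat.card_pos.ne')⟩,
    (natCast_zsmul h _).trans hcard⟩

section IntegralGroupRing

variable {G M : Type*} [Group G] [AddCommGroup M] [Module (MonoidAlgebra ℤ G) M]

theorem isNestedFamily_image_Iio {π : Finset Nat.Primes} {x : ℕ → M}
    (hx : ∀ p ∈ π, genBy G (x '' Iio (genRankMod G M p)) ⊔ modMul G M p = ⊤) :
    IsNestedFamily G π fun p : π ↦ x '' Iio (genRankMod G M p) := by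
  have hcard (p : π) : (x '' Iio (genRankMod G M p)).encard = genRankMod G M p := by
    obtain ⟨n, hn⟩ := ENat.ne_top_iff_exists.1
      ((Set.finite_Iio (genRankMod G M p)).image x).encard_lt_top.ne
    refine (encard_image_Iio_le x _).antisymm (hn ▸ Nat.cast_le.2 ?_)
    exact genRank_quotient_le_of_encard_le hn.ge (hx p p.2)
  refine ⟨fun p ↦ hx p p.2, hcard, fun p q ↦ ⟨fun h ↦ ?_, fun h ↦ ?_⟩⟩
  · have hle := Set.encard_le_encard h
    rwa [hcard, hcard, Nat.cast_le] at hle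
  · exact Set.image_mono (Set.Iio_subset_Iio h)

variable [Module.Finite (MonoidAlgebra ℤ G) M]

variable (G M) in
theorem exists_forall_genBy_image_Iio_sup_modMul_eq_top (π : Finset Nat.Primes) :
    ∃ v : ℕ → M, ∀ p ∈ π, genBy G (v '' Iio (genRankMod G M p)) ⊔ modMul G M p = ⊤ := by
  choose y hy using fun p : Nat.Primes ↦
    genRank_quotient_le_iff.1 (le_refl (genRankMod G M p))
  choose v hv using fun i ↦ exists_forall_sModEq_multiples (R := MonoidAlgebra ℤ G) π
    (pairwise_coprime_primes _) fun p ↦ y p i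
  exact ⟨v, fun p hp ↦ (span_image_sup_congr fun i _ ↦ hv i p hp).trans (hy p)⟩

variable [Finite G]

theorem genRankMod_le_of_notMem {p : Nat.Primes} (hp : p ∉ groupPrimes G ∪ addGroupPrimes M)
    (q : Nat.Primes) : genRankMod G M p ≤ genRankMod G M q := by
  have : Module.Finite ℤ M := .trans (MonoidAlgebra ℤ G) M
  rw [Set.mem_union, not_or] at hp
  have (K : Submodule (MonoidAlgebra ℤ G) M) :
      IsSemisimpleModule (MonoidAlgebra ℤ G) (Reduction (MonoidAlgebra ℤ G) K p) :=
    isSemisimpleModule_of_prime_nsmul_eq_zero p.2 (not_dvd_card_of_notMem_groupPrimes hp.1)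
      nsmul_reduction_eq_zero
  exact genRank_reduction_le p.2 (isSMulRegular_of_notMem_addGroupPrimes hp.2) q.2.ne_one

variable (G M)

theorem exists_isNestedFamily (π : Finset Nat.Primes)
    (hπ : groupPrimes G ∪ addGroupPrimes M ⊂ (π : Set Nat.Primes)) :
    ∃ (X : π → Set M) (Y : Set M), IsNestedFamily G π X ∧ IsMinimalElement X Y ∧
      ∀ p : Nat.Primes, p ∉ π →
        genRank (MonoidAlgebra ℤ G) (M ⧸ (genBy G Y ⊔ modMul G M p)) ≤ 1 := by
  have : Module.Finite ℤ M := .trans (MonoidAlgebra ℤ G) M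
  obtain ⟨q, hqπ, hq⟩ := Set.exists_of_ssubset hπ
  obtain ⟨v, hv⟩ := exists_forall_genBy_image_Iio_sup_modMul_eq_top G M π
  have hvq : Submodule.span (MonoidAlgebra ℤ G) (v '' Iio (genRankMod G M q)) ⊔ ⊥ ⊔
      multiples (MonoidAlgebra ℤ G) M q = ⊤ := by
    rw [sup_bot_eq]
    exact hv q hqπ
  have hrank (p : Nat.Primes) (hp : p ∉ π) : genRank (MonoidAlgebra ℤ G)
      (M ⧸ (⊥ ⊔ multiples (MonoidAlgebra ℤ G) M p)) ≤ genRankMod G M q + 1 := by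
    rw [bot_sup_eq]
    exact (genRankMod_le_of_notMem (fun h ↦ hp (hπ.subset h)) q).trans (Nat.le_succ _)
  obtain ⟨x, hxv, hx⟩ := exists_sModEq_forall_genRank_quotient_le_one hqπ hvq hrank
  have hgen (p : Nat.Primes) (hp : p ∈ π) :
      genBy G (x '' Iio (genRankMod G M p)) ⊔ modMul G M p = ⊤ :=
    (span_image_sup_congr fun i _ ↦ hxv p hp i).trans (hv p hp)
  refine ⟨_, x '' Iio (genRankMod G M q), isNestedFamily_image_Iio hgen,
    ⟨⟨⟨q, hqπ⟩, rfl⟩, fun p ↦ ?_⟩, fun p hp ↦ ?_⟩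
  · exact Set.image_mono (Set.Iio_subset_Iio (genRankMod_le_of_notMem hq p))
  · have hxp := hx p hp
    rwa [sup_bot_eq] at hxp

theorem isGoodWith_groupPrimes_union_addGroupPrimes :
    IsGoodWith G M (groupPrimes G ∪ addGroupPrimes M) := by
  have : Module.Finite ℤ M := .trans (MonoidAlgebra ℤ G) M
  have hfin : (groupPrimes G ∪ addGroupPrimes M).Finite :=
    (finite_groupPrimes G).union (finite_addGroupPrimes M)
  refine ⟨hfin, ?_, fun π hπ ↦ ?_⟩
  · obtain ⟨p, hp⟩ := hfin.exists_notMem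
    exact ⟨genRankMod G M p, fun q hq ↦ (genRankMod_le_of_notMem hq p).antisymm
      (genRankMod_le_of_notMem hp q), fun q _ ↦ genRankMod_le_of_notMem hp q⟩
  · obtain ⟨X, Y, hX, ⟨⟨q, hq⟩, hle⟩, hY⟩ := exists_isNestedFamily G M π hπ
    obtain ⟨n, hn, hnY⟩ := exists_coprime_forall_nsmul_mem (hq ▸ hX.generates q)
    have hn0 : 0 < n := Nat.pos_of_ne_zero fun h ↦
      q.1.2.ne_one ((Nat.coprime_zero_left _).1 (h ▸ hn))
    refine ⟨X, Y, hX, ⟨⟨q, hq⟩, hle⟩, fun p hp ↦ ?_, n, hn0, fun z ↦ ?_⟩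
    · rw [sup_comm]
      exact hY p hp
    · obtain ⟨m, rfl⟩ := Submodule.mkQ_surjective _ z
      rw [← map_nsmul]
      exact (Submodule.Quotient.mk_eq_zero _).2 (hnY m)

end IntegralGroupRing

theorem theorem7p1 (G : Type*) [Group G] [Finite G] (M : Type*) [AddCommGroup M]
    [Module (MonoidAlgebra ℤ G) M] [Module.Finite (MonoidAlgebra ℤ G) M] :
    (∀ π : Finset Nat.Primes, groupPrimes G ∪ addGroupPrimes M ⊂ (π : Set Nat.Primes) →
      ∃ (X : π → Set M) (Y : Set M), IsNestedFamily G π X ∧ IsMinimalElement X Y ∧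
        ∀ p : Nat.Primes, p ∉ π →
          genRank (MonoidAlgebra ℤ G) (M ⧸ (genBy G Y ⊔ modMul G M p)) ≤ 1) ∧
    IsGoodWith G M (groupPrimes G ∪ addGroupPrimes M) ∧
    IsGood G M :=
  have hgood := isGoodWith_groupPrimes_union_addGroupPrimes G M
  ⟨exists_isNestedFamily G M, hgood, _, hgood⟩
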